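/- **Model (synchronous broadcast, adaptive adversary).** There are $n$ nodes, a finite field $\mathbb F_q$ with $q$ elements, and $k$ messages $m_1,\dots,m_k\in\mathbb F_q^d$; each message is initially known to at least one node (the adversary decides to which). A packet is a pair $(\mu,m)\in\mathbb F_q^k\times\mathbb F_q^d$ of a coefficient vector and a payload. A node that initially knows $m_i$ keeps the packet $(e_i,m_i)$ active and unchanged forever. In addition every node has $s\ge 1$ memory slots, initially zero (empty), whose contents are active packets too. In each round, knowing everything that happened in the previous rounds, the adversary chooses a directed graph $G$ on the nodes; then every node $u$ independently draws a uniformly random packet from the span of its active packets, and this packet is delivered to all $v$ with an edge $u\to v$ in $G$. Each node then updates its slots, according to one of the finite-memory (FM-RLNC) protocols: - *accumulator*: to each slot it adds an independent, uniformly random linear combination of the incoming packets; - *recombinator*: each slot is refilled with an independent, uniformly random element of the span of the node's active packets and the incoming packets. In the *full RLNC* protocol, instead, all received packets stay active (together with those of the initially known messages). A node *can decode* when the packets it initially knew or has received so far (active or not) determine all messages: for each $i$ their span contains a packet with coefficient vector $e_i$, and the payload of every such packet is $m_i$. A directed graph is *strongly $l$-vertex-connected* if it has more than $l$ vertices and remains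 strongly connected after deletion of any fewer than $l$ vertices (an undirected graph is regarded as a symmetric directed graph). **Lemma.** There is an absolute constant $C>0$ such that the following holds. Let $q=n^{\omega(1)}$, i.e. let $\omega:\mathbb N\to\mathbb R$ with $\omega(n)\to\infty$ and assume $q\ge n^{\omega(n)}$. Then for every $c>0$ there is an $N=N(\omega,c)$ such that for all $n\ge N$, all such finite fields $\mathbb F_q$, all $s\ge1$ (in particular $s=1$), both FM-RLNC protocols, all $k$ and $d$, all messages and initial distributions of them, all $l\ge1$, and all adaptive adversaries whose graph is strongly $l$-vertex-connected in every round: for every integer $T\ge C\left(\frac nl+k\right)$, the probability that after $T$ rounds some node cannot decode all $k$ messages is at most $n^{-cT}$. In particular, the $k$ messages are spread to all nodes in $O\!\left(\frac nl+k\right)$ rounds with (exponentially) high probability. The same bound holds for the full RLNC protocol. -/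

import Mathlib

noncomputable section

namespace FMRLNC

/-- A directed graph is strongly `l`-vertex-connected if it has more than `l` vertices and the
deletion of any fewer than `l` vertices leaves a strongly connected graph.  An undirected graph is
a symmetric directed graph, and for those this is the usual `l`-vertex-connectivity. -/
def StronglyVertexConnected {V : Type} [Fintype V] (l : ℕ) (G : Digraph V) : Prop :=
  l < Fintype.card V ∧
    ∀ S : Finset V, S.card < l → ∀ u, u ∉ S → ∀ v, v ∉ S →
      Relation.ReflTransGen (fun a b => G.Adj a b ∧ b ∉ S) u v

/-- A packet `(μ, m)`: a coefficient vector in `F ^ k` and a payload in `F ^ d`. -/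
abbrev Packet (F : Type) (k d : ℕ) : Type := (Fin k → F) × (Fin d → F)

/-- The protocols: full RLNC, which keeps all received packets active, and the two finite-memory
variants, accumulator and recombinator FM-RLNC. -/
inductive Protocol where
  | rlnc
  | accumulator
  | recombinator

/-- What happens in one round: the topology, the packet broadcast by each node, and the contents of
the `s` memory slots of each node at the end of the round. -/
structure Round (V F : Type) (s k d : ℕ) where
  graph : Digraph V
  sent : V → Packet F k d
  stored : V → Fin s → Packet F k d

/-- The complete record of the rounds played so far, the most recent round first. -/
abbrev History (V F : Type) (s k d : ℕ) : Type := List (Round V F s k d)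

/-- An adaptive adversary: it fixes the topology of a round knowing everything that happened in the
previous rounds, but before the packets of the current round are drawn. -/
abbrev Adversary (V F : Type) (s k d : ℕ) : Type := History V F s k d → Digraph V

/-- The uniform distribution on a finite nonempty type.  On a product of finite types it makes the
coordinates independent and uniform. -/
def uniform (α : Type) [Finite α] [Nonempty α] : PMF α :=
  letI := Fintype.ofFinite α
  PMF.uniformOfFintype α

section Model

variable {V F : Type} [Fintype V] [Field F] [Finite F] {s k d : ℕ}

/-- The packet `(eᵢ, mᵢ)` of the `i`-th message. -/
def messagePacket (m : Fin k → Fin d → F) (i : Fin k) : Packet F k d := (Pi.single i 1, m i)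

/-- The packets of the messages a node knows initially; `init v` is the set of indices of these
messages. -/
def sourcePackets (m : Fin k → Fin d → F) (init : V → Set (Fin k)) (v : V) :
    Set (Packet F k d) :=
  messagePacket m '' init v

/-- The contents of the memory slots of the nodes, all of them zero (empty) in the beginning. -/
def stored : History V F s k d → V → Fin s → Packet F k d
  | [] => fun _ _ => 0
  | r :: _ => r.stored

/-- The packets a node has received so far. -/
def received (h : History V F s k d) (v : V) : Set (Packet F k d) :=
  {x | ∃ r ∈ h, ∃ u, r.graph.Adj u v ∧ x = r.sent u}

/-- The active packets of a node.  In each protocol, a node that knows messages initially keeps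
their packets active and unchanged.  Apart from them, the active packets are all received packets
for RLNC, and those in the `s` memory slots for the finite-memory variants. -/
def active (p : Protocol) (m : Fin k → Fin d → F) (init : V → Set (Fin k))
    (h : History V F s k d) (v : V) : Set (Packet F k d) :=
  match p with
  | .rlnc => sourcePackets m init v ∪ received h v
  | .accumulator => sourcePackets m init v ∪ Set.range (stored h v)
  | .recombinator => sourcePackets m init v ∪ Set.range (stored h v)

/-- Every node independently draws a uniformly random packet from the span of its active packets. -/
def sendDist (p : Protocol) (m : Fin k → Fin d → F) (init : V → Set (Fin k))
    (h : History V F s k d) : PMF (V → Packet F k d) :=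
  (uniform ((u : V) → Submodule.span F (active p m init h u))).map
    fun x u => (x u : Packet F k d)

open Classical in
/-- The new contents of the memory slots after the packets `sent` are delivered along the edges
of `G`.
* Accumulator: to each slot, an independent uniformly random linear combination of the incoming
  packets is added.
* Recombinator: each slot is refilled by an independent uniformly random element of the span of the
  active and the incoming packets.
* Full RLNC does not use the slots. -/
def storeDist (p : Protocol) (m : Fin k → Fin d → F) (init : V → Set (Fin k))
    (h : History V F s k d) (G : Digraph V) (sent : V → Packet F k d) :
    PMF (V → Fin s → Packet F k d) :=
  match p with
  | .rlnc => PMF.pure (stored h)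
  | .accumulator =>
      (uniform (V → Fin s → V → F)).map
        fun a v i => stored h v i + ∑ u ∈ Finset.univ.filter (fun u => G.Adj u v), a v i u • sent u
  | .recombinator =>
      (uniform ((v : V) → Fin s →
          Submodule.span F (active .recombinator m init h v ∪ sent '' {u | G.Adj u v}))).map
        fun y v i => (y v i : Packet F k d)

/-- The distribution of the history of the first `t` rounds of the synchronous broadcast model
against the adversary `adv`. -/
def historyDist (p : Protocol) (m : Fin k → Fin d → F) (init : V → Set (Fin k))
    (adv : Adversary V F s k d) : ℕ → PMF (History V F s k d)
  | 0 => PMF.pure []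
  | t + 1 =>
      (historyDist p m init adv t).bind fun h =>
        (sendDist p m init h).bind fun x =>
          (storeDist p m init h (adv h) x).map fun y => ⟨adv h, x, y⟩ :: h

/-- A node can decode all messages: from the packets it knew initially or received so far one can
linearly combine a packet with coefficient vector `eᵢ`, for every `i`, and the payload of every such
combination is the `i`-th message. -/
def Decodes (m : Fin k → Fin d → F) (init : V → Set (Fin k)) (h : History V F s k d) (v : V) :
    Prop :=
  ∀ (i : Fin k) (y : Fin d → F),
    ((Pi.single i 1, y) : Packet F k d) ∈
      Submodule.span F (sourcePackets m init v ∪ received h v) ↔ y = m i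

end Model

end FMRLNC

end

namespace FMRLNC

open scoped ENNReal

/-! Fix a nonzero `μ` and test packets by the inner product `φ` of their coefficient vectors with
`μ`. If every node has at some time held an active packet with `φ ≠ 0`, for each such `μ`, then no
proper subspace contains the coefficient vectors a node can generate, and all nodes decode
(`decodes_of_completed`).

For one `μ`, awareness of `φ` spreads like a rumour. An aware node sends a packet with `φ = 0` with
probability at most `1/q`, and a node that is aware or receives a packet with `φ ≠ 0` ends the round
unaware with probability at most `1/q`. If no aware node fails in sending, strong connectivity
brings in `l` new nodes or all remaining ones. Nodes with finite memory may forget, so progress is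
measured in expectation by `w ^ #unaware` with `w ^ l = r = q ^ (1/4)`: every round shrinks it by a
factor `2K/r`, whatever the history and hence whatever the adaptive adversary does
(`expect_potential_step_le`). Forgetting after completion is harmless, since decoding uses all
packets ever received; the potential is therefore set to zero from then on.

Markov's inequality bounds the failure probability for one `μ` by `(2K/r) ^ T * w ^ n`. A union
bound over at most `q ^ k` vectors `μ` (`historyDist_not_decodes_le`) still leaves `n ^ (-cT)`. -/

/-- The expectation of a nonnegative function under a discrete distribution. -/
noncomputable def expect {α : Type} (p : PMF α) (f : α → ℝ≥0∞) : ℝ≥0∞ := ∑' a, p a * f a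

/-! ### Expectations under discrete distributions. -/

section Expectation

variable {α β : Type}

theorem expect_pure (a : α) (f : α → ℝ≥0∞) : expect (PMF.pure a) f = f a := by
  unfold expect
  rw [tsum_eq_single a]
  · simp
  · intro b hb
    simp [PMF.pure_apply, hb]

theorem expect_bind (p : PMF α) (g : α → PMF β) (f : β → ℝ≥0∞) :
    expect (p.bind g) f = expect p fun a => expect (g a) f := by
  unfold expect
  simp only [PMF.bind_apply, ← ENNReal.tsum_mul_right, ← ENNReal.tsum_mul_left]
  rw [ENNReal.tsum_comm]
  simp only [mul_assoc]

theorem expect_map (p : PMF α) (g : α → β) (f : β → ℝ≥0∞) :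
    expect (p.map g) f = expect p fun a => f (g a) := by
  unfold PMF.map
  rw [expect_bind]
  simp only [Function.comp_apply, expect_pure]

theorem expect_mono (p : PMF α) {f g : α → ℝ≥0∞} (h : ∀ a, f a ≤ g a) :
    expect p f ≤ expect p g :=
  ENNReal.tsum_le_tsum fun a => by gcongr; exact h a

theorem expect_const_mul (p : PMF α) (c : ℝ≥0∞) (f : α → ℝ≥0∞) :
    expect p (fun a => c * f a) = c * expect p f := by
  unfold expect
  rw [← ENNReal.tsum_mul_left]
  exact tsum_congr fun a => by ring

theorem expect_add (p : PMF α) (f g : α → ℝ≥0∞) :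
    expect p (fun a => f a + g a) = expect p f + expect p g := by
  unfold expect
  simp only [mul_add, ENNReal.tsum_add]

theorem expect_const (p : PMF α) (c : ℝ≥0∞) : expect p (fun _ => c) = c := by
  unfold expect
  rw [ENNReal.tsum_mul_right, PMF.tsum_coe, one_mul]

theorem expect_sum {ι : Type} (p : PMF α) (s : Finset ι) (f : ι → α → ℝ≥0∞) :
    expect p (fun a => ∑ i ∈ s, f i a) = ∑ i ∈ s, expect p (f i) := by
  classical
  induction s using Finset.induction_on with
  | empty => simpa using expect_const p 0
  | insert i s hi ih => simp only [Finset.sum_insert hi, expect_add, ih]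

theorem toOuterMeasure_le_expect (p : PMF α) (s : Set α) (f : α → ℝ≥0∞)
    (h : ∀ a ∈ p.support, a ∈ s → 1 ≤ f a) : p.toOuterMeasure s ≤ expect p f := by
  rw [PMF.toOuterMeasure_apply]
  refine ENNReal.tsum_le_tsum fun a => ?_
  by_cases ha : a ∈ s
  · by_cases hp : p a = 0
    · simp [ha, hp]
    · rw [Set.indicator_of_mem ha]
      exact le_mul_of_one_le_right' (h a ((PMF.mem_support_iff _ _).2 hp) ha)
  · simp [ha]

theorem expect_uniform [Fintype α] [Nonempty α] (f : α → ℝ≥0∞) :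
    expect (uniform α) f = (Fintype.card α : ℝ≥0∞)⁻¹ * ∑ a, f a := by
  have : uniform α = PMF.uniformOfFintype α := by
    unfold uniform
    congr!
  unfold expect
  simp only [this, PMF.uniformOfFintype_apply, tsum_fintype, Finset.mul_sum]

theorem expect_uniform_prod {V : Type} [Fintype V] {W : V → Type} [∀ v, Finite (W v)]
    [∀ v, Nonempty (W v)] (f : ∀ v, W v → ℝ≥0∞) :
    expect (uniform (∀ v, W v)) (fun y => ∏ v, f v (y v)) =
      ∏ v, expect (uniform (W v)) (f v) := by
  classical
  have := fun v => Fintype.ofFinite (W v)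
  simp only [expect_uniform, Finset.prod_mul_distrib]
  rw [Finset.prod_univ_sum, Fintype.piFinset_univ, Fintype.card_pi, Nat.cast_prod,
    ENNReal.prod_inv_distrib]
  intro i _ j _ _
  exact Or.inr (ENNReal.natCast_ne_top _)

end Expectation

/-! ### Zeros of affine functionals at uniform points. -/

section Uniform

variable {F W : Type} [Field F] [Finite F] [AddCommGroup W] [Module F W] [Finite W]

/-- The translates of the zero set by the multiples of a vector `y₀` with `φ y₀ = 1` are `q`
disjoint copies of it inside `W`. -/
theorem expect_uniform_affine_eq_zero_le (φ : W →ₗ[F] F) (hφ : φ ≠ 0) (c : F)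
    [DecidablePred fun y => c + φ y = 0] :
    expect (uniform W) (fun y => if c + φ y = 0 then 1 else 0) ≤ (Nat.card F : ℝ≥0∞)⁻¹ := by
  have := Fintype.ofFinite F
  have := Fintype.ofFinite W
  obtain ⟨y₀, hy₀⟩ : ∃ y, φ y = 1 := LinearMap.surjective hφ 1
  have hinj : Function.Injective
      fun a : {y // c + φ y = 0} × F => (a.1 : W) + a.2 • y₀ := by
    rintro ⟨⟨y, hy⟩, a⟩ ⟨⟨z, hz⟩, b⟩ h
    simp only at h
    have h' := congrArg (fun x => c + φ x) h
    simp only [map_add, map_smul, hy₀, smul_eq_mul, mul_one, ← add_assoc, hy, hz, zero_add] at h'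
    subst h'
    simpa using h
  have hcard := Fintype.card_le_of_injective _ hinj
  rw [Fintype.card_prod, Fintype.card_subtype] at hcard
  rw [expect_uniform, Finset.sum_boole, Nat.card_eq_fintype_card, mul_comm, ← div_eq_mul_inv,
    ← one_div]
  have hF : (Fintype.card F : ℝ≥0∞) ≠ 0 := by simp
  have hW : (Fintype.card W : ℝ≥0∞) ≠ 0 := by simp
  rw [ENNReal.div_le_iff hW (ENNReal.natCast_ne_top _), one_div, mul_comm, ← div_eq_mul_inv,
    ENNReal.le_div_iff_mul_le (Or.inl hF) (Or.inl (ENNReal.natCast_ne_top _))]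
  exact_mod_cast hcard

theorem expect_uniform_le_one_add (φ : W →ₗ[F] F) (hφ : φ ≠ 0) (c : F) (b : ℝ≥0∞)
    (f : W → ℝ≥0∞) (hf : ∀ y, c + φ y ≠ 0 → f y ≤ 1) (hb : ∀ y, f y ≤ 1 + b) :
    expect (uniform W) f ≤ 1 + b / Nat.card F := by
  classical
  calc expect (uniform W) f
      ≤ expect (uniform W) (fun y => 1 + b * if c + φ y = 0 then 1 else 0) := by
        refine expect_mono _ fun y => ?_
        split_ifs with h
        · simpa using hb y
        · simpa using hf y h
    _ ≤ 1 + b / Nat.card F := by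
        rw [expect_add, expect_const, expect_const_mul, div_eq_mul_inv]
        gcongr
        exact expect_uniform_affine_eq_zero_le φ hφ c

end Uniform

/-! ### Vertex expansion from strong connectivity. -/

section Graph

variable {V : Type} [Fintype V] [DecidableEq V]

/-- If `B \ S` had fewer than `l` vertices and some `v` lay outside `B`, deleting `B \ S` would
leave a path from `S` to `v`; but edges out of `S` end in `B`, so that path never leaves `S`. -/
theorem StronglyVertexConnected.eq_univ_or_card_compl_add_le {l : ℕ} {G : Digraph V}
    (hG : StronglyVertexConnected l G) {S B : Finset V} (hS : S.Nonempty) (hSB : S ⊆ B)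
    (hadj : ∀ u ∈ S, ∀ v, G.Adj u v → v ∈ B) : B = Finset.univ ∨ Bᶜ.card + l ≤ Sᶜ.card := by
  rw [or_iff_not_imp_right, not_le]
  intro hlt
  rw [Finset.eq_univ_iff_forall]
  by_contra! ⟨v, hv⟩
  obtain ⟨u, hu⟩ := hS
  have hcard : (B \ S).card < l := by
    have h1 := Finset.card_sdiff_add_card_eq_card hSB
    have h2 := Finset.card_add_card_compl B
    have h3 := Finset.card_add_card_compl S
    omega
  have hpath := hG.2 (B \ S) hcard u (by simp [hu]) v (by simp [hv])
  have : v ∈ S := by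
    clear hv
    induction hpath with
    | refl => exact hu
    | tail _ hab ih =>
      have := hadj _ ih _ hab.1
      have h2 := hab.2
      rw [Finset.mem_sdiff, not_and_not_right] at h2
      exact h2 this
  exact hv (hSB this)

end Graph

/-! ### Awareness of a functional and the potential. -/

section Awareness

variable {V F : Type} [Field F] {s k d : ℕ}

/-- A node is aware of a functional if the functional does not vanish on its active packets. -/
def Aware (φ : Packet F k d →ₗ[F] F) (p : Protocol) (m : Fin k → Fin d → F)
    (init : V → Set (Fin k)) (h : History V F s k d) (v : V) : Prop :=
  ∃ x ∈ active p m init h v, φ x ≠ 0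

variable (φ : Packet F k d →ₗ[F] F) (p : Protocol) (m : Fin k → Fin d → F)
  (init : V → Set (Fin k))

theorem sourcePackets_subset_active (h : History V F s k d) (v : V) :
    sourcePackets m init v ⊆ active p m init h v := by
  cases p <;> exact Set.subset_union_left

theorem aware_of_source (h : History V F s k d) {v : V} {i : Fin k} (hi : i ∈ init v)
    (hφ : φ (messagePacket m i) ≠ 0) : Aware φ p m init h v :=
  ⟨_, sourcePackets_subset_active p m init h v ⟨i, hi, rfl⟩, hφ⟩

/-- Everybody has been aware of the functional at the same time. -/
def Completed (h : History V F s k d) : Prop :=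
  ∃ h', h' <:+ h ∧ ∀ v, Aware φ p m init h' v

variable {φ p m init} in
theorem Completed.cons {h : History V F s k d} (hc : Completed φ p m init h)
    (r : Round V F s k d) : Completed φ p m init (r :: h) := by
  obtain ⟨h', hh', ha⟩ := hc
  exact ⟨h', hh'.trans (List.suffix_cons r h), ha⟩

variable [Fintype V]

open Classical in
/-- The nodes that are aware of a functional. -/
noncomputable def awareNodes (h : History V F s k d) : Finset V :=
  Finset.univ.filter (Aware φ p m init h)

theorem mem_awareNodes {h : History V F s k d} {v : V} :
    v ∈ awareNodes φ p m init h ↔ Aware φ p m init h v := by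
  simp [awareNodes]

open Classical in
/-- The potential `w ^ #unaware`, dropping to zero once everybody has been aware. -/
noncomputable def potential (w : ℝ≥0∞) (h : History V F s k d) : ℝ≥0∞ :=
  if Completed φ p m init h then 0 else w ^ (awareNodes φ p m init h)ᶜ.card

variable {φ p m init}

open Classical in
theorem prod_aware_ite_le (B : Finset V) {w : ℝ≥0∞} (hw : 1 ≤ w) (h : History V F s k d) :
    w ^ (awareNodes φ p m init h)ᶜ.card ≤
      w ^ Bᶜ.card * ∏ v ∈ B, if Aware φ p m init h v then 1 else w := by
  rw [Finset.prod_ite, Finset.prod_const_one, one_mul, Finset.prod_const, ← pow_add]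
  refine pow_le_pow_right₀ hw ?_
  refine le_trans (Finset.card_le_card ?_) (Finset.card_union_le _ _)
  intro v hv
  by_cases hB : v ∈ B <;> simp_all [awareNodes]

open Classical in
theorem potential_le (B : Finset V) {w : ℝ≥0∞} (hw : 1 ≤ w) (h : History V F s k d) :
    potential φ p m init w h ≤
      w ^ Bᶜ.card * ∏ v ∈ B, if Aware φ p m init h v then 1 else w := by
  unfold potential
  split_ifs
  · exact zero_le
  · exact prod_aware_ite_le B hw h

-- Before completion at least one node is unaware, so a full extra factor `r` can be charged to the
-- unaware nodes. This serves rounds that reach everybody, where fewer than `l` new nodes may be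
-- available to pay for the decrease.
open Classical in
theorem potential_mul_le {w r : ℝ≥0∞} (hr : 1 ≤ r) (h : History V F s k d) :
    potential φ p m init w h * r ≤ ∏ v, if Aware φ p m init h v then 1 else w * r := by
  unfold potential
  split_ifs with hc
  · simp
  · rw [Finset.prod_ite, Finset.prod_const_one, one_mul, Finset.prod_const]
    have : (awareNodes φ p m init h)ᶜ = Finset.univ.filter fun v => ¬ Aware φ p m init h v := by
      ext v
      simp [awareNodes]
    rw [this, mul_pow]
    gcongr
    refine le_self_pow₀ hr ?_
    rw [Finset.card_ne_zero]
    by_contra hne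
    rw [Finset.not_nonempty_iff_eq_empty, Finset.filter_eq_empty_iff] at hne
    exact hc ⟨h, List.suffix_rfl, fun v => not_not.1 (hne (Finset.mem_univ v))⟩

/-! ### The expected change of the potential in one round. -/

variable [Finite F]

-- Nodes fill their slots independently, so the expectation factors over nodes. For each node of `B`
-- a single slot suffices: its `φ`-value is either surely nonzero or a nonconstant affine function
-- of the uniform randomness, hence zero with probability at most `1/q`.
variable (φ p m init) in
open Classical in
theorem expect_storeDist_le (hs : 1 ≤ s) (h : History V F s k d) (G : Digraph V)
    (x : V → Packet F k d) (B : Finset V)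
    (hB : ∀ v ∈ B, Aware φ p m init h v ∨ ∃ u, G.Adj u v ∧ φ (x u) ≠ 0) (b : ℝ≥0∞) :
    expect (storeDist p m init h G x)
      (fun y => ∏ v ∈ B, if Aware φ p m init (⟨G, x, y⟩ :: h) v then 1 else b) ≤
      (1 + b / Nat.card F) ^ Fintype.card V := by
  have hle : ∀ P : Prop, (if P then 1 else b) ≤ 1 + b := fun P => by
    split_ifs
    · exact le_self_add
    · exact le_add_self
  have hprod : ∀ f : V → ℝ≥0∞, (∀ v, f v ≤ 1 + b / Nat.card F) →
      ∏ v, f v ≤ (1 + b / Nat.card F) ^ Fintype.card V := fun f hf =>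
    Finset.prod_le_pow_card _ _ _ fun v _ => hf v
  cases p with
  | rlnc =>
    rw [storeDist, expect_pure, Finset.prod_eq_one]
    · exact one_le_pow₀ le_self_add
    · intro v hv
      rw [if_pos]
      rcases hB v hv with ⟨z, hz, hφ⟩ | ⟨u, hu, hφ⟩
      · refine ⟨z, ?_, hφ⟩
        rcases hz with hz | ⟨r, hr, hz⟩
        · exact Or.inl hz
        · exact Or.inr ⟨r, List.mem_cons_of_mem _ hr, hz⟩
      · exact ⟨_, Or.inr ⟨_, List.mem_cons_self, u, hu, rfl⟩, hφ⟩
  | accumulator =>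
    let f : V → (Fin s → V → F) → ℝ≥0∞ := fun v a =>
      if v ∈ B then
        if ∃ z ∈ sourcePackets m init v ∪ Set.range fun i => stored h v i +
          ∑ u ∈ Finset.univ.filter (fun u => G.Adj u v), a i u • x u, φ z ≠ 0 then 1 else b
      else 1
    have hf : ∀ v, expect (uniform (Fin s → V → F)) (f v) ≤ 1 + b / Nat.card F := by
      intro v
      by_cases hv : v ∈ B
      swap
      · simp only [f, hv, if_false, expect_const]
        exact le_self_add
      by_cases hin : ∃ u, G.Adj u v ∧ φ (x u) ≠ 0
      · obtain ⟨u, hu, hφ⟩ := hin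
        -- `φ` of the updated slot `i` is `φ (stored h v i) + ψ a`; a neighbour `u` with `φ (x u) ≠
        -- 0` makes `ψ` nonzero.
        let i : Fin s := ⟨0, hs⟩
        let ψ : (Fin s → V → F) →ₗ[F] F :=
          ∑ u ∈ Finset.univ.filter (fun u => G.Adj u v),
            φ (x u) • ((LinearMap.proj u : (V → F) →ₗ[F] F) ∘ₗ
              (LinearMap.proj i : (Fin s → V → F) →ₗ[F] V → F))
        have hψ : ∀ a, ψ a = ∑ u ∈ Finset.univ.filter (fun u => G.Adj u v), φ (x u) * a i u := by
          intro a
          simp [ψ, LinearMap.sum_apply]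
        refine expect_uniform_le_one_add ψ ?_ (φ (stored h v i)) b _ ?_ ?_
        · intro h0
          have := hψ fun _ => Pi.single u 1
          rw [h0, LinearMap.zero_apply, Finset.sum_eq_single u] at this
          · simp at this
            exact hφ this.symm
          · intro w _ hw
            simp [hw]
          · simp [hu]
        · intro a ha
          simp only [f, hv, if_true]
          rw [if_pos]
          refine ⟨_, Or.inr ⟨i, rfl⟩, ?_⟩
          rw [hψ] at ha
          simpa [map_sum, mul_comm] using ha
        · intro a
          simp only [f, hv, if_true]
          exact hle _
      -- Every incoming packet has `φ = 0`, so the added combinations leave the `φ`-value of each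
      -- slot unchanged and `v` surely stays aware.
      · have haw := (hB v hv).resolve_right hin
        push Not at hin
        obtain ⟨z, hz, hφ⟩ := haw
        refine (expect_mono _ (g := fun _ => 1) fun a => ?_).trans
          ((expect_const _ _).le.trans le_self_add)
        simp only [f, hv, if_true]
        rw [if_pos]
        rcases hz with hz | ⟨i, rfl⟩
        · exact ⟨z, Or.inl hz, hφ⟩
        · refine ⟨_, Or.inr ⟨i, rfl⟩, ?_⟩
          rw [map_add, map_sum, Finset.sum_eq_zero, add_zero]
          · exact hφ
          · intro u hu
            rw [map_smul, hin u (Finset.mem_filter.1 hu).2, smul_zero]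
    rw [storeDist, expect_map]
    calc _ = expect (uniform (V → Fin s → V → F)) (fun a => ∏ v, f v (a v)) := by
          simp only [f, Finset.prod_ite_mem, Finset.univ_inter]
          rfl
      _ ≤ _ := by
          rw [expect_uniform_prod]
          exact hprod _ hf
  | recombinator =>
    let E : V → Submodule F (Packet F k d) := fun v =>
      Submodule.span F (active .recombinator m init h v ∪ x '' {u | G.Adj u v})
    let f : (v : V) → (Fin s → E v) → ℝ≥0∞ := fun v y =>
      if v ∈ B then
        if ∃ z ∈ sourcePackets m init v ∪ Set.range fun i => (y i : Packet F k d),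
          φ z ≠ 0 then 1 else b
      else 1
    have hf : ∀ v, expect (uniform (Fin s → E v)) (f v) ≤ 1 + b / Nat.card F := by
      intro v
      by_cases hv : v ∈ B
      swap
      · simp only [f, hv, if_false, expect_const]
        exact le_self_add
      let i : Fin s := ⟨0, hs⟩
      refine expect_uniform_le_one_add (φ ∘ₗ (E v).subtype ∘ₗ LinearMap.proj i) ?_ 0 b _ ?_ ?_
      · intro h0
        obtain ⟨z, hz, hφ⟩ : ∃ z ∈ active .recombinator m init h v ∪ x '' {u | G.Adj u v},
            φ z ≠ 0 := by
          rcases hB v hv with ⟨z, hz, hφ⟩ | ⟨u, hu, hφ⟩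
          · exact ⟨z, Or.inl hz, hφ⟩
          · exact ⟨_, Or.inr ⟨u, hu, rfl⟩, hφ⟩
        exact hφ (LinearMap.congr_fun h0 fun _ => ⟨z, Submodule.subset_span hz⟩)
      · intro y hy
        simp only [f, hv, if_true]
        rw [if_pos]
        exact ⟨_, Or.inr ⟨i, rfl⟩, by simpa using hy⟩
      · intro y
        simp only [f, hv, if_true]
        exact hle _
    rw [storeDist, expect_map]
    calc _ = expect (uniform ((v : V) → Fin s → E v)) (fun a => ∏ v, f v (a v)) := by
          simp only [f, Finset.prod_ite_mem, Finset.univ_inter]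
          rfl
      _ ≤ _ := by
          rw [expect_uniform_prod]
          exact hprod _ hf

variable (φ p m init) in
open Classical in
theorem expect_sendDist_le (h : History V F s k d) {u : V} (hu : Aware φ p m init h u) :
    expect (sendDist p m init h) (fun x => if φ (x u) = 0 then 1 else 0) ≤
      (Nat.card F : ℝ≥0∞)⁻¹ := by
  rw [sendDist, expect_map]
  obtain ⟨z, hz, hφ⟩ := hu
  let E : V → Submodule F (Packet F k d) := fun u => Submodule.span F (active p m init h u)
  have h0 : φ ∘ₗ (E u).subtype ∘ₗ LinearMap.proj (φ := fun u => E u) u ≠ 0 := by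
    intro h0
    apply hφ
    simpa using LinearMap.congr_fun h0 (Pi.single u ⟨z, Submodule.subset_span hz⟩)
  refine (expect_mono _ fun x => ?_).trans (expect_uniform_affine_eq_zero_le _ h0 0)
  simp [E]

/-- Two events each contribute `K/r`: either some aware node sends a packet with `φ = 0`, which has
probability at most `n/q ≤ 1/r`, or the informed set grows enough to gain the factor `r`. The
constant `K` absorbs the failures in storing. -/
theorem expect_potential_step_le (hs : 1 ≤ s) {l : ℕ} {h : History V F s k d} {G : Digraph V}
    (hG : StronglyVertexConnected l G) (hne : (awareNodes φ p m init h).Nonempty)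
    {w r K : ℝ≥0∞} (hw : 1 ≤ w) (hr : 1 ≤ r) (hr' : r ≠ ∞) (hl : w ^ l = r)
    (hV : Fintype.card V / Nat.card F ≤ r⁻¹)
    (hK : (1 + w * r / Nat.card F) ^ Fintype.card V ≤ K) :
    expect (sendDist p m init h) (fun x => expect (storeDist p m init h G x)
      fun y => potential φ p m init w (⟨G, x, y⟩ :: h)) ≤
      2 * K * r⁻¹ * potential φ p m init w h := by
  classical
  have hr0 : r ≠ 0 := (zero_lt_one.trans_le hr).ne'
  by_cases hc : Completed φ p m init h
  · have : ∀ r, potential φ p m init w (r :: h) = 0 := fun r => if_pos (hc.cons r)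
    simp [this, expect_const]
  set S := awareNodes φ p m init h with hS
  have hpot : potential φ p m init w h = w ^ Sᶜ.card := if_neg hc
  have hx : ∀ x, expect (storeDist p m init h G x)
      (fun y => potential φ p m init w (⟨G, x, y⟩ :: h)) ≤
      K * w ^ Sᶜ.card * (r⁻¹ + ∑ u ∈ S, if φ (x u) = 0 then 1 else 0) := by
    intro x
    set B : Finset V := Finset.univ.filter fun v =>
      Aware φ p m init h v ∨ ∃ u, G.Adj u v ∧ φ (x u) ≠ 0 with hBdef
    have hB : ∀ v ∈ B, Aware φ p m init h v ∨ ∃ u, G.Adj u v ∧ φ (x u) ≠ 0 :=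
      fun v hv => (Finset.mem_filter.1 hv).2
    have hSB : S ⊆ B := fun v hv =>
      Finset.mem_filter.2 ⟨Finset.mem_univ _, Or.inl (Finset.mem_filter.1 hv).2⟩
    have hgen : expect (storeDist p m init h G x)
        (fun y => potential φ p m init w (⟨G, x, y⟩ :: h)) ≤ K * w ^ Bᶜ.card := by
      refine (expect_mono _ fun y => potential_le B hw _).trans ?_
      rw [expect_const_mul, mul_comm]
      gcongr
      refine (expect_storeDist_le φ p m init hs h G x B hB w).trans (le_trans ?_ hK)
      gcongr
      exact le_mul_of_one_le_right' hr
    -- In the bad case nothing is gained from the graph, but `S ⊆ B` still keeps the potential from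
    -- growing by more than `K`.
    by_cases hbad : ∃ u ∈ S, φ (x u) = 0
    · obtain ⟨u, hu, hφ⟩ := hbad
      refine hgen.trans ?_
      rw [← mul_one (K * w ^ _)]
      gcongr
      refine le_add_left ?_
      refine le_trans ?_ (Finset.single_le_sum (fun _ _ => zero_le) hu)
      simp [hφ]
    · push Not at hbad
      suffices hsuff : expect (storeDist p m init h G x)
          (fun y => potential φ p m init w (⟨G, x, y⟩ :: h)) ≤ K * w ^ Sᶜ.card * r⁻¹ by
        refine hsuff.trans ?_
        gcongr
        exact le_self_add
      rw [← div_eq_mul_inv, ENNReal.le_div_iff_mul_le (Or.inl hr0) (Or.inl hr')]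
      rcases hG.eq_univ_or_card_compl_add_le (S := S) (B := B) hne hSB (fun u hu v huv =>
        Finset.mem_filter.2 ⟨Finset.mem_univ _, Or.inr ⟨u, huv, hbad u hu⟩⟩) with hu | hcard
      · rw [hu] at hB
        rw [mul_comm, ← expect_const_mul]
        refine (expect_mono _ fun y => (mul_comm r _).le.trans (potential_mul_le hr _)).trans ?_
        refine (expect_storeDist_le φ p m init hs h G x _ hB (w * r)).trans (hK.trans ?_)
        exact le_mul_of_one_le_right' (one_le_pow₀ hw)
      · calc _ ≤ K * w ^ Bᶜ.card * r := by gcongr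
          _ = K * w ^ (Bᶜ.card + l) := by rw [pow_add, hl, mul_assoc]
          _ ≤ _ := by gcongr
  refine (expect_mono _ hx).trans ?_
  rw [expect_const_mul, expect_add, expect_const, expect_sum, hpot]
  have hsum : ∑ u ∈ S, expect (sendDist p m init h) (fun x => if φ (x u) = 0 then 1 else 0) ≤
      r⁻¹ := by
    refine (Finset.sum_le_card_nsmul _ _ _ fun u hu =>
      expect_sendDist_le φ p m init h (Finset.mem_filter.1 hu).2).trans (le_trans ?_ hV)
    rw [nsmul_eq_mul, div_eq_mul_inv]
    gcongr
    exact Finset.card_le_univ _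
  calc _ ≤ K * w ^ Sᶜ.card * (r⁻¹ + r⁻¹) := by gcongr
    _ = _ := by ring

theorem expect_potential_le (hs : 1 ≤ s) {l : ℕ} {adv : Adversary V F s k d}
    (hG : ∀ h, StronglyVertexConnected l (adv h)) {v : V} {i : Fin k} (hi : i ∈ init v)
    (hφ : φ (messagePacket m i) ≠ 0)
    {w r K : ℝ≥0∞} (hw : 1 ≤ w) (hr : 1 ≤ r) (hr' : r ≠ ∞) (hl : w ^ l = r)
    (hV : Fintype.card V / Nat.card F ≤ r⁻¹)
    (hK : (1 + w * r / Nat.card F) ^ Fintype.card V ≤ K) (T : ℕ) :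
    expect (historyDist p m init adv T) (potential φ p m init w) ≤
      (2 * K * r⁻¹) ^ T * w ^ Fintype.card V := by
  induction T with
  | zero =>
    rw [historyDist, expect_pure, pow_zero, one_mul, potential]
    split_ifs
    · exact zero_le
    · exact pow_le_pow_right₀ hw (Finset.card_le_univ _)
  | succ T ih =>
    rw [historyDist, expect_bind]
    simp only [expect_bind, expect_map]
    refine (expect_mono _ fun h => expect_potential_step_le hs (hG h) ?_ hw hr hr' hl hV
      hK).trans ?_
    -- A node that initially knows message `i` keeps its packet active, so the rumour never dies
    -- out.
    · exact ⟨v, (mem_awareNodes φ p m init).2 (aware_of_source φ p m init h hi hφ)⟩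
    · rw [expect_const_mul, pow_succ', mul_assoc (2 * K * r⁻¹)]
      gcongr

theorem historyDist_not_completed_le (hs : 1 ≤ s) {l : ℕ} {adv : Adversary V F s k d}
    (hG : ∀ h, StronglyVertexConnected l (adv h)) {v : V} {i : Fin k} (hi : i ∈ init v)
    (hφ : φ (messagePacket m i) ≠ 0)
    {w r K : ℝ≥0∞} (hw : 1 ≤ w) (hr : 1 ≤ r) (hr' : r ≠ ∞) (hl : w ^ l = r)
    (hV : Fintype.card V / Nat.card F ≤ r⁻¹)
    (hK : (1 + w * r / Nat.card F) ^ Fintype.card V ≤ K) (T : ℕ) :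
    (historyDist p m init adv T).toOuterMeasure {h | ¬ Completed φ p m init h} ≤
      (2 * K * r⁻¹) ^ T * w ^ Fintype.card V := by
  classical
  refine (toOuterMeasure_le_expect _ _ (potential φ p m init w) fun h _ hc => ?_).trans
    (expect_potential_le hs hG hi hφ hw hr hr' hl hV hK T)
  rw [potential, if_neg hc]
  exact one_le_pow₀ hw

end Awareness

/-! ### From awareness to decoding. -/

section Decoding

variable {V F : Type} {s k d : ℕ}

theorem received_mono {h h' : History V F s k d} (hh : h' <:+ h) (v : V) :
    received h' v ⊆ received h v := by
  rintro x ⟨r, hr, hx⟩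
  exact ⟨r, hh.subset hr, hx⟩

theorem mem_received_cons {h : History V F s k d} {r : Round V F s k d} {u v : V}
    (hu : r.graph.Adj u v) : r.sent u ∈ received (r :: h) v :=
  ⟨r, List.mem_cons_self, u, hu, rfl⟩

variable [Field F] {p : Protocol} {m : Fin k → Fin d → F} {init : V → Set (Fin k)}

variable (p m init) in
/-- The records that can arise: active packets are combinations of packets a node has seen, and all
received packets are combinations of the messages. -/
structure Consistent (h : History V F s k d) : Prop where
  active_subset : ∀ h', h' <:+ h → ∀ v, active p m init h' v ⊆
    Submodule.span F (sourcePackets m init v ∪ received h' v)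
  received_subset : ∀ v, received h v ⊆ Submodule.span F (Set.range (messagePacket m))

theorem Consistent.span_le {h : History V F s k d} (hh : Consistent p m init h) (v : V) :
    Submodule.span F (sourcePackets m init v ∪ received h v) ≤
      Submodule.span F (Set.range (messagePacket m)) := by
  rw [Submodule.span_le]
  refine Set.union_subset ?_ (hh.received_subset v)
  exact (Set.image_subset_range _ _).trans Submodule.subset_span

/-- The inner product of a vector with the coefficient vector of a packet. -/
def coeffFunctional (d : ℕ) (μ : Fin k → F) : Packet F k d →ₗ[F] F :=
  dotProductBilin F F μ ∘ₗ LinearMap.fst F _ _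

theorem coeffFunctional_apply (μ : Fin k → F) (x : Packet F k d) :
    coeffFunctional d μ x = ∑ i, μ i * x.1 i := rfl

theorem coeffFunctional_messagePacket (μ : Fin k → F) (i : Fin k) :
    coeffFunctional d μ (messagePacket m i) = μ i := by
  simp [coeffFunctional_apply, messagePacket, Pi.single_apply]

theorem snd_eq_of_mem_span_messagePacket {x : Packet F k d}
    (hx : x ∈ Submodule.span F (Set.range (messagePacket m))) : x.2 = ∑ i, x.1 i • m i := by
  obtain ⟨c, rfl⟩ := (Submodule.mem_span_range_iff_exists_fun F).1 hx
  simp [messagePacket, Prod.snd_sum, Prod.fst_sum, Finset.sum_apply, Pi.single_apply]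

/-- If the coefficient vectors in a node's span formed a proper subspace, a nonzero functional would
vanish on it; that functional is an inner product with some `μ`, contradicting the node's awareness
at an earlier time. Payloads are right because all packets are combinations of the `messagePacket m
i`. -/
theorem decodes_of_completed {h : History V F s k d} (hh : Consistent p m init h)
    (hc : ∀ μ : Fin k → F, μ ≠ 0 → Completed (coeffFunctional d μ) p m init h) (v : V) :
    Decodes m init h v := by
  set E := Submodule.span F (sourcePackets m init v ∪ received h v) with hE
  have htop : E.map (LinearMap.fst F (Fin k → F) (Fin d → F)) = ⊤ := by
    by_contra hne
    obtain ⟨f, hf, hfE⟩ := Submodule.exists_le_ker_of_lt_top _ (lt_top_iff_ne_top.2 hne)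
    have hfμ : ∀ c : Fin k → F, f c = ∑ i, f (Pi.single i 1) * c i := by
      intro c
      conv_lhs => rw [pi_eq_sum_univ' c]
      simp [map_sum, mul_comm]
    obtain ⟨h', hh', ha⟩ := hc (fun i => f (Pi.single i 1)) fun h0 => hf <| by
      ext c
      simpa using congrFun h0 c
    obtain ⟨z, hz, hφ⟩ := ha v
    apply hφ
    rw [coeffFunctional_apply, ← hfμ]
    refine hfE ⟨z, ?_, rfl⟩
    exact Submodule.span_mono (Set.union_subset_union_right _ (received_mono hh' v))
      (hh.active_subset h' hh' v hz)
  have hsnd : ∀ (i : Fin k) (y : Fin d → F), ((Pi.single i 1, y) : Packet F k d) ∈ E →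
      y = m i := by
    intro i y hy
    simpa [Pi.single_apply] using snd_eq_of_mem_span_messagePacket (hh.span_le v hy)
  intro i y
  refine ⟨hsnd i y, ?_⟩
  rintro rfl
  obtain ⟨⟨c, z⟩, hz, hc⟩ : Pi.single i 1 ∈ E.map (LinearMap.fst F (Fin k → F) (Fin d → F)) :=
    htop ▸ Submodule.mem_top
  obtain rfl : c = Pi.single i 1 := hc
  rwa [← hsnd i z hz]

variable [Fintype V] [Finite F]

theorem stored_mem_span_of_mem_support (hp : p ≠ .rlnc) {h : History V F s k d} {G : Digraph V}
    {x : V → Packet F k d} {y : V → Fin s → Packet F k d}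
    (hy : y ∈ (storeDist p m init h G x).support) (v : V) (i : Fin s) :
    y v i ∈ Submodule.span F (active p m init h v ∪ x '' {u | G.Adj u v}) := by
  classical
  cases p with
  | rlnc => exact absurd rfl hp
  | accumulator =>
    rw [storeDist, PMF.support_map] at hy
    obtain ⟨a, -, rfl⟩ := hy
    refine Submodule.add_mem _ (Submodule.subset_span (Or.inl (Or.inr ⟨i, rfl⟩))) ?_
    refine Submodule.sum_mem _ fun u hu => Submodule.smul_mem _ _ (Submodule.subset_span ?_)
    exact Or.inr ⟨u, (Finset.mem_filter.1 hu).2, rfl⟩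
  | recombinator =>
    rw [storeDist, PMF.support_map] at hy
    obtain ⟨a, -, rfl⟩ := hy
    exact (a v i).2

theorem Consistent.cons {h : History V F s k d} (hh : Consistent p m init h) {G : Digraph V}
    {x : V → Packet F k d} {y : V → Fin s → Packet F k d}
    (hx : x ∈ (sendDist p m init h).support) (hy : y ∈ (storeDist p m init h G x).support) :
    Consistent p m init (⟨G, x, y⟩ :: h) := by
  have hspan : ∀ v, Submodule.span F (active p m init h v) ≤
      Submodule.span F (sourcePackets m init v ∪ received h v) := fun v =>
    Submodule.span_le.2 (hh.active_subset h List.suffix_rfl v)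
  refine ⟨fun h' hh' v => ?_, fun v => ?_⟩
  · rcases List.suffix_cons_iff.1 hh' with rfl | hh'
    swap
    · exact hh.active_subset h' hh' v
    by_cases hp : p = .rlnc
    · subst hp
      exact Submodule.subset_span
    have : active p m init (⟨G, x, y⟩ :: h) v = sourcePackets m init v ∪ Set.range (y v) := by
      cases p
      · exact absurd rfl hp
      all_goals rfl
    rw [this]
    refine Set.union_subset (Set.subset_union_left.trans Submodule.subset_span) ?_
    rintro _ ⟨i, rfl⟩
    refine Submodule.span_le.2 (Set.union_subset ?_ ?_)
      (stored_mem_span_of_mem_support hp hy v i)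
    · refine (hh.active_subset h List.suffix_rfl v).trans (Submodule.span_mono ?_)
      exact Set.union_subset_union_right _ (received_mono (List.suffix_cons _ _) v)
    · rintro _ ⟨u, hu, rfl⟩
      exact Submodule.subset_span (Or.inr (mem_received_cons hu))
  · rintro _ ⟨r, hr, u, hu, rfl⟩
    rcases List.mem_cons.1 hr with rfl | hr
    · rw [sendDist, PMF.support_map] at hx
      obtain ⟨a, -, rfl⟩ := hx
      exact hh.span_le u (hspan u (a u).2)
    · exact hh.received_subset v ⟨r, hr, u, hu, rfl⟩

theorem consistent_of_mem_support {adv : Adversary V F s k d} {T : ℕ} {h : History V F s k d}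
    (hh : h ∈ (historyDist p m init adv T).support) : Consistent p m init h := by
  induction T generalizing h with
  | zero =>
    rw [historyDist, PMF.support_pure, Set.mem_singleton_iff] at hh
    subst hh
    refine ⟨fun h' hh' v => ?_, fun v => ?_⟩
    · rw [List.suffix_nil.1 hh']
      cases p
      · exact Submodule.subset_span
      all_goals
        refine Set.union_subset (Set.subset_union_left.trans Submodule.subset_span) ?_
        rintro _ ⟨i, rfl⟩
        exact Submodule.zero_mem _
    · rintro _ ⟨r, hr, -⟩
      simp at hr
  | succ T ih =>
    simp only [historyDist, PMF.mem_support_bind_iff, PMF.support_map, Set.mem_image] at hh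
    obtain ⟨h', hh', x, hx, y, hy, rfl⟩ := hh
    exact (ih hh').cons hx hy

theorem historyDist_not_decodes_le (hs : 1 ≤ s) (hinit : ∀ i, ∃ v, i ∈ init v) {l : ℕ}
    {adv : Adversary V F s k d} (hG : ∀ h, StronglyVertexConnected l (adv h))
    {w r K : ℝ≥0∞} (hw : 1 ≤ w) (hr : 1 ≤ r) (hr' : r ≠ ∞) (hl : w ^ l = r)
    (hV : Fintype.card V / Nat.card F ≤ r⁻¹)
    (hK : (1 + w * r / Nat.card F) ^ Fintype.card V ≤ K) (T : ℕ) :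
    (historyDist p m init adv T).toOuterMeasure {h | ¬ ∀ v, Decodes m init h v} ≤
      (Nat.card F) ^ k * ((2 * K * r⁻¹) ^ T * w ^ Fintype.card V) := by
  classical
  have := Fintype.ofFinite F
  set P := (historyDist p m init adv T).toOuterMeasure
  -- No node is ever aware of the zero functional, so `μ = 0` must be left out.
  let bad : (Fin k → F) → Set (History V F s k d) := fun μ =>
    if μ = 0 then ∅ else {h | ¬ Completed (coeffFunctional d μ) p m init h}
  calc P {h | ¬ ∀ v, Decodes m init h v}
      ≤ P (⋃ μ, bad μ) := by
        refine PMF.toOuterMeasure_mono _ ?_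
        rintro h ⟨hh, hsupp⟩
        by_contra hc
        refine hh fun v => decodes_of_completed (consistent_of_mem_support hsupp) (fun μ hμ => ?_) v
        by_contra hn
        refine hc (Set.mem_iUnion.2 ⟨μ, ?_⟩)
        simpa [bad, hμ] using hn
    _ ≤ ∑ μ, P (bad μ) := MeasureTheory.measure_iUnion_fintype_le _ _
    _ ≤ ∑ _μ : Fin k → F, (2 * K * r⁻¹) ^ T * w ^ Fintype.card V := by
        refine Finset.sum_le_sum fun μ _ => ?_
        by_cases hμ : μ = 0
        · simp [bad, hμ]
        · obtain ⟨i, hi⟩ := Function.ne_iff.1 hμ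
          obtain ⟨v, hv⟩ := hinit i
          simp only [bad, hμ, if_false]
          refine historyDist_not_completed_le hs hG hv ?_ hw hr hr' hl hV hK T
          rwa [coeffFunctional_messagePacket]
    _ = _ := by
        rw [Finset.sum_const, nsmul_eq_mul, Finset.card_univ, Fintype.card_fun, Fintype.card_fin,
          Nat.card_eq_fintype_card, Nat.cast_pow]

end Decoding

/-! ### Choice of parameters. -/

theorem one_add_pow_le_three {n : ℕ} {x : ℝ} (hx : 0 ≤ x) (hnx : n * x ≤ 1) :
    (1 + x) ^ n ≤ 3 := by
  calc (1 + x) ^ n ≤ Real.exp x ^ n := by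
        gcongr
        linarith [Real.add_one_le_exp x]
    _ = Real.exp (n * x) := (Real.exp_nat_mul x n).symm
    _ ≤ Real.exp 1 := Real.exp_le_exp.2 hnx
    _ ≤ 3 := by linarith [Real.exp_one_lt_d9]

/-- The exponent of `Q` is `k + n/(4l) - T/4`, at most `-T/8` because `n/l + k ≤ T/8`. Then `6 ≤ n ^
3` turns `6 ^ T` into `n ^ (3T)`, which the `3` in `8 * (c + 3)` pays for. -/
theorem card_pow_mul_le {n l k T : ℕ} {Q ω c : ℝ} (hn : 2 ≤ n) (hω : 8 * (c + 3) ≤ ω)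
    (hc : 0 < c) (hQ : (n : ℝ) ^ ω ≤ Q) (hT : 8 * ((n : ℝ) / l + k) ≤ T) :
    Q ^ k * ((6 * (Q ^ (4⁻¹ : ℝ))⁻¹) ^ T * (Q ^ ((4 * l : ℝ)⁻¹)) ^ n) ≤
      (n : ℝ) ^ (-(c * T)) := by
  have hn' : (2 : ℝ) ≤ n := by exact_mod_cast hn
  have hn0 : (0 : ℝ) < n := by linarith
  have hQ1 : 1 ≤ Q := (Real.one_le_rpow (by linarith) (by linarith)).trans hQ
  have hQ0 : 0 < Q := by linarith
  have hT0 : (0 : ℝ) ≤ T := T.cast_nonneg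
  have hl0 : (0 : ℝ) ≤ n / l := by positivity
  calc Q ^ k * ((6 * (Q ^ (4⁻¹ : ℝ))⁻¹) ^ T * (Q ^ ((4 * l : ℝ)⁻¹)) ^ n)
      = 6 ^ T * Q ^ ((k : ℝ) - 4⁻¹ * T + (4 * l : ℝ)⁻¹ * n) := by
        rw [Real.rpow_add hQ0, Real.rpow_sub hQ0, Real.rpow_mul hQ0.le, Real.rpow_mul hQ0.le,
          Real.rpow_natCast, Real.rpow_natCast, Real.rpow_natCast, mul_pow, inv_pow]
        ring
    _ ≤ 6 ^ T * Q ^ (-(T / 8 : ℝ)) := by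
        gcongr
        have : (4 * l : ℝ)⁻¹ * n = n / l / 4 := by
          rw [mul_inv]
          ring
        rw [this]
        linarith [(k.cast_nonneg : (0 : ℝ) ≤ k)]
    _ ≤ 6 ^ T * ((n : ℝ) ^ ω) ^ (-(T / 8 : ℝ)) := by
        gcongr 6 ^ T * ?_
        exact Real.rpow_le_rpow_of_nonpos (by positivity) hQ (by linarith)
    _ = 6 ^ T * (n : ℝ) ^ (-(ω * (T / 8))) := by
        rw [← Real.rpow_mul hn0.le, mul_neg]
    _ ≤ ((n : ℝ) ^ 3) ^ T * (n : ℝ) ^ (-(8 * (c + 3) * (T / 8))) := by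
        gcongr
        · have : (2 : ℝ) ^ 3 ≤ (n : ℝ) ^ 3 := by gcongr
          linarith
        · linarith
    _ = (n : ℝ) ^ (-(c * T)) := by
        rw [← pow_mul, ← Real.rpow_natCast, ← Real.rpow_add hn0]
        congr 1
        push_cast
        ring

end FMRLNC

theorem mainTheorem1 :
    ∃ C : ℝ, 0 < C ∧
      ∀ ω : ℕ → ℝ, Filter.Tendsto ω Filter.atTop Filter.atTop →
      ∀ c : ℝ, 0 < c →
      ∃ N : ℕ, ∀ n : ℕ, N ≤ n →
      ∀ (F : Type) [Field F] [Finite F], (n : ℝ) ^ ω n ≤ (Nat.card F : ℝ) →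
      ∀ (p : FMRLNC.Protocol) (s : ℕ), 1 ≤ s →
      ∀ (k d : ℕ) (m : Fin k → Fin d → F)
        (init : Fin n → Set (Fin k)), (∀ i, ∃ v, i ∈ init v) →
      ∀ (l : ℕ), 1 ≤ l →
      ∀ adv : FMRLNC.Adversary (Fin n) F s k d,
        (∀ h, FMRLNC.StronglyVertexConnected l (adv h)) →
      ∀ T : ℕ, C * ((n : ℝ) / l + k) ≤ T →
        (FMRLNC.historyDist p m init adv T).toOuterMeasure
            {h | ¬ ∀ v, FMRLNC.Decodes m init h v}
          ≤ ENNReal.ofReal ((n : ℝ) ^ (-(c * T))) := by 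
  refine ⟨8, by norm_num, fun ω hω c hc => ?_⟩
  obtain ⟨N, hN⟩ := Filter.eventually_atTop.1 (hω.eventually_ge_atTop (8 * (c + 3)))
  -- `n ≥ 2` is what gives `6 ≤ n ^ 3`.
  refine ⟨max N 2, fun n hn F _ _ hF p s hs k d m init hinit l hl adv hG T hT => ?_⟩
  have hn2 : 2 ≤ n := (le_max_right _ _).trans hn
  have hωn := hN n ((le_max_left _ _).trans hn)
  have hn' : (2 : ℝ) ≤ n := by exact_mod_cast hn2
  have hl' : (1 : ℝ) ≤ l := by exact_mod_cast hl
  have hfinal := FMRLNC.card_pow_mul_le hn2 hωn hc hF hT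
  set Q : ℝ := (Nat.card F : ℝ) with hQdef
  -- The exponent `4` makes `n ≤ r = Q ^ (1/4)`, so `n/Q ≤ 1/r` and `n * w * r ≤ r ^ 3 ≤ Q`; the
  -- latter allows `K = 3 > e`.
  have hnQ : (n : ℝ) ^ (4 : ℝ) ≤ Q :=
    (Real.rpow_le_rpow_of_exponent_le (by linarith) (by linarith)).trans hF
  have hQ1 : 1 ≤ Q := (Real.one_le_rpow (by linarith) (by norm_num)).trans hnQ
  have hQ0 : 0 < Q := by linarith
  set r : ℝ := Q ^ (4⁻¹ : ℝ) with hr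
  set w : ℝ := Q ^ ((4 * l : ℝ)⁻¹) with hw
  have hnr : (n : ℝ) ≤ r := by
    have := Real.rpow_le_rpow (by positivity) hnQ (by norm_num : (0 : ℝ) ≤ 4⁻¹)
    rwa [← Real.rpow_mul (by linarith), mul_inv_cancel₀ (by norm_num), Real.rpow_one] at this
  have hr1 : 1 ≤ r := by linarith
  have hr0 : 0 < r := by linarith
  have hw1 : 1 ≤ w := Real.one_le_rpow hQ1 (by positivity)
  have hwl : w ^ l = r := by
    rw [hw, hr, ← Real.rpow_natCast, ← Real.rpow_mul hQ0.le]
    congr 1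
    field_simp
  have hwr : w ≤ r := hwl ▸ le_self_pow₀ hw1 (by omega)
  have hrQ : r ^ 4 = Q := by
    rw [hr, ← Real.rpow_natCast, ← Real.rpow_mul hQ0.le]
    norm_num
  have hQE : (Nat.card F : ENNReal) = ENNReal.ofReal Q := (ENNReal.ofReal_natCast _).symm
  have hnE : (n : ENNReal) = ENNReal.ofReal n := (ENNReal.ofReal_natCast _).symm
  have hV : n / Q ≤ r⁻¹ := by
    rw [div_le_iff₀ hQ0, ← hrQ, pow_succ' r 3, inv_mul_cancel_left₀ hr0.ne']
    exact hnr.trans (le_self_pow₀ hr1 (by norm_num))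
  have hK : (1 + w * r / Q) ^ n ≤ 3 := by
    refine FMRLNC.one_add_pow_le_three (by positivity) ?_
    rw [← mul_div_assoc, div_le_one hQ0, ← hrQ]
    calc (n : ℝ) * (w * r) ≤ r * (r * r) := by gcongr
      _ = r ^ 3 := by ring
      _ ≤ r ^ 4 := pow_le_pow_right₀ hr1 (by norm_num)
  refine (FMRLNC.historyDist_not_decodes_le (w := ENNReal.ofReal w) (r := ENNReal.ofReal r)
    (K := 3) hs hinit hG ?_ ?_ ENNReal.ofReal_ne_top ?_ ?_ ?_ T).trans ?_
  · exact ENNReal.one_le_ofReal.2 hw1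
  · exact ENNReal.one_le_ofReal.2 hr1
  · rw [← ENNReal.ofReal_pow (by linarith), hwl]
  · rw [Fintype.card_fin, hQE, hnE, ← ENNReal.ofReal_div_of_pos hQ0,
      ← ENNReal.ofReal_inv_of_pos hr0]
    exact ENNReal.ofReal_le_ofReal hV
  · rw [Fintype.card_fin, hQE, ← ENNReal.ofReal_mul (by linarith),
      ← ENNReal.ofReal_div_of_pos hQ0, ← ENNReal.ofReal_one,
      ← ENNReal.ofReal_add (by norm_num) (by positivity), ← ENNReal.ofReal_pow (by positivity)]
    exact (ENNReal.ofReal_le_ofReal hK).trans_eq (by simp)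
  · refine le_trans (le_of_eq ?_) (ENNReal.ofReal_le_ofReal hfinal)
    have h6 : (2 * 3 : ENNReal) = ENNReal.ofReal 6 := by
      rw [ENNReal.ofReal_ofNat]
      norm_num
    rw [Fintype.card_fin, hQE, h6, ← ENNReal.ofReal_inv_of_pos hr0,
      ← ENNReal.ofReal_mul (by norm_num), ← ENNReal.ofReal_pow (by positivity),
      ← ENNReal.ofReal_pow (by positivity), ← ENNReal.ofReal_pow (by positivity),
      ← ENNReal.ofReal_mul (by positivity), ← ENNReal.ofReal_mul (by positivity)]
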